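/- Let $G$ be an arbitrary group (no topology, no amenability is assumed). For a function $\phi: G\to\mathbb{C}$ and $g_1,\dots,g_n\in G$ consider the matrix $A=(\phi(g_i^{-1}g_j))_{i,j=1}^n$. The function $\phi$ is called - positive definite if $\phi(g^{-1})=\overline{\phi(g)}$ for all $g\in G$ and, for all $n\in\mathbb{N}$ and all $g_1,\dots,g_n\in G$, the Hermitian matrix $A$ is positive semidefinite (has no negative eigenvalues); - positive definite of finite type if it is positive definite and $\phi(g)=(\pi(g)x,x)$ for all $g\in G$, for some unitary representation $\pi$ of $G$ on a finite-dimensional complex Hilbert space $H$ and some $x\in H$; - quasi-positive definite if $\phi(g^{-1})=\overline{\phi(g)}$ for all $g\in G$ and there is $k\in\mathbb{N}$ such that, for all $n\in\mathbb{N}$ and all $g_1,\dots,g_n\in G$, the Hermitian matrix $A$ has at most $k$ negative eigenvalues, counted with multiplicity. Theorem. Every bounded quasi-positive definite function $\phi$ on $G$ can be written in the form \[ \phi(g)=\phi_1(g)-\phi_2(g)\qquad(g\in G), \] where $\phi_1$ is a positive definite function on $G$ and $\phi_2$ is a positive definite function of finite type on $G$. -/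

import Mathlib

open scoped ComplexConjugate ComplexOrder

namespace QuasiPD

variable {G : Type*} [Group G]

/-- Hermitian symmetry of a function on a group: `φ(g⁻¹)` is the complex conjugate of `φ(g)`. -/
def HermitianSymm (φ : G → ℂ) : Prop := ∀ g, φ g⁻¹ = conj (φ g)

/-- The matrix `(φ(gᵢ⁻¹ gⱼ))ᵢⱼ` attached to an `n`-tuple of elements of the group. -/
def kernelMatrix (φ : G → ℂ) {n : ℕ} (g : Fin n → G) : Matrix (Fin n) (Fin n) ℂ :=
  Matrix.of fun i j => φ ((g i)⁻¹ * g j)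

theorem HermitianSymm.isHermitian {φ : G → ℂ} (h : HermitianSymm φ) {n : ℕ} (g : Fin n → G) :
    (kernelMatrix φ g).IsHermitian := by
  ext i j
  have := h ((g j)⁻¹ * g i)
  simp only [mul_inv_rev, inv_inv] at this
  simp [kernelMatrix, this]

/-- Positive definite functions on a group. -/
def IsPD (φ : G → ℂ) : Prop :=
  HermitianSymm φ ∧ ∀ (n : ℕ) (g : Fin n → G), (kernelMatrix φ g).PosSemidef

/-- Quasi-positive definite functions: the matrices `(φ(gᵢ⁻¹ gⱼ))` have at most `k` negative
eigenvalues, counted with multiplicity, with `k` independent of the tuple. -/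
def IsQPD (φ : G → ℂ) : Prop :=
  ∃ h : HermitianSymm φ, ∃ k : ℕ, ∀ (n : ℕ) (g : Fin n → G),
    (Finset.univ.filter fun i => (h.isHermitian g).eigenvalues i < 0).card ≤ k

/-- Positive definite functions of finite type: those of the form `g ↦ (π(g)x, x)` for a
unitary representation `π` on a finite-dimensional Hilbert space. (The inner product of Mathlib is
linear in the second argument; every finite-dimensional Hilbert space is isometric to one
in `Type`.) -/
def IsPDFiniteType (φ : G → ℂ) : Prop :=
  IsPD φ ∧ ∃ (H : Type) (_ : NormedAddCommGroup H) (_ : InnerProductSpace ℂ H)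
    (_ : FiniteDimensional ℂ H) (π : G →* (H ≃ₗᵢ[ℂ] H)) (x : H),
    ∀ g, φ g = inner ℂ x (π g x)

end QuasiPD

/-!
The form `[x, y] = ∑ conj(x_g) φ(g⁻¹h) y_h` on finitely supported functions on `G` is invariant
under translations and has finitely many negative squares. A positive definite function
`θ = φ + 2ψ` with `ψ` and `φ + ψ` positive definite is enough: on the Hilbert space of `θ` the group
acts unitarily, and `[·, ·]` becomes `⟨·, J ·⟩` with `J` self-adjoint, bounded and commuting with
the group. If `J = T² - S²` with `T² = J⁺` and `S² = J⁻`, then for the cyclic vector `x`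
`φ(g) = ⟨Tx, U(g)Tx⟩ - ⟨Sx, U(g)Sx⟩`, and `S` has finite rank because the form is negative definite
on its range (`IsQPD.exists_decomposition`).

Finding `ψ` (`IsQPD.exists_dominating`) is a fixed point problem. A maximal negative orthonormal
family `n` turns the form into the positive semidefinite majorant `[x, y] + 2 ∑ [x, nᵢ][nᵢ, y]`.
Since `φ` is bounded, translations are uniformly bounded for the majorant
(`exists_majorant_translate_le`), hence also for the Hilbert–Schmidt norm it induces on tensors. The
kernels `P` with `0 ≤ P` and `0 ≤ φ + P` given by tensors form a convex translation-invariant set,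
nonempty because it contains `∑ nᵢ ⊗ conj nᵢ`. The supremum of a Hilbert norm over a uniformly
bounded group of operators is an invariant uniformly convex norm, so a minimizing sequence in that
set is Cauchy and almost fixed (`exists_cauchySeq_almost_fixed`). Its limit is an invariant kernel,
which is `(g, h) ↦ ψ(g⁻¹h)`. No amenability is needed, since uniform convexity replaces averaging.
-/

open Filter Topology

universe u

namespace QuasiPD

/-! ### Sesquilinear forms of infinite matrices and the Kolmogorov decomposition -/

section

variable {α β : Type*}

/-- The sesquilinear form `(x, y) ↦ ∑ conj(xᵢ) Kᵢⱼ yⱼ` on finitely supported vectors defined by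
a matrix `K` with an arbitrary index type; conjugate-linear in the first argument. -/
noncomputable def sesq (K : Matrix α α ℂ) : (α →₀ ℂ) →ₗ⋆[ℂ] (α →₀ ℂ) →ₗ[ℂ] ℂ :=
  LinearMap.mk₂'ₛₗ (starRingEnd ℂ) (RingHom.id ℂ)
    (fun x y => x.sum fun i a => y.sum fun j b => star a * K i j * b)
    (fun x x' y => by
      rw [Finsupp.sum_add_index'] <;> simp [← Finsupp.sum_add, add_mul])
    (fun c x y => by
      rw [Finsupp.sum_smul_index] <;> simp [Finsupp.mul_sum, mul_assoc])
    (fun x y y' => by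
      rw [← Finsupp.sum_add]
      congr! 3 with i a
      rw [Finsupp.sum_add_index'] <;> simp [mul_add])
    (fun c x y => by
      simp only [RingHom.id_apply, smul_eq_mul, Finsupp.mul_sum]
      congr! 3 with i a
      rw [Finsupp.sum_smul_index]
      · congr! 3 with j b
        ring
      · simp)

theorem sesq_apply (K : Matrix α α ℂ) (x y : α →₀ ℂ) :
    sesq K x y = x.sum fun i a => y.sum fun j b => star a * K i j * b := rfl

@[simp]
theorem sesq_single_single (K : Matrix α α ℂ) (i j : α) (a b : ℂ) :
    sesq K (Finsupp.single i a) (Finsupp.single j b) = conj a * K i j * b := by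
  simp [sesq_apply]

theorem sesq_single_left (K : Matrix α α ℂ) (i : α) (y : α →₀ ℂ) :
    sesq K (Finsupp.single i 1) y = y.sum fun j b => K i j * b := by
  simp [sesq_apply]

theorem sesq_single_right (K : Matrix α α ℂ) (x : α →₀ ℂ) (j : α) :
    sesq K x (Finsupp.single j 1) = x.sum fun i a => conj a * K i j := by
  simp [sesq_apply]

theorem sesq_form_ext {S T : (α →₀ ℂ) →ₗ⋆[ℂ] (α →₀ ℂ) →ₗ[ℂ] ℂ}
    (h : ∀ i j, S (Finsupp.single i 1) (Finsupp.single j 1) =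
      T (Finsupp.single i 1) (Finsupp.single j 1)) : S = T := by
  have hs : ∀ (i : α) (a : ℂ), Finsupp.single i a = a • Finsupp.single i (1 : ℂ) := by simp
  refine LinearMap.ext fun x => ?_
  induction x using Finsupp.induction_linear with
  | zero => simp
  | add x x' hx hx' => simp [hx, hx']
  | single i a =>
    refine LinearMap.ext fun y => ?_
    induction y using Finsupp.induction_linear with
    | zero => simp
    | add y y' hy hy' => simp only [map_add, hy, hy']
    | single j b =>
      rw [hs i a, hs j b]
      simp only [map_smulₛₗ, LinearMap.smul_apply, h]

theorem sesq_add (K L : Matrix α α ℂ) : sesq (K + L) = sesq K + sesq L :=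
  sesq_form_ext fun i j => by simp

theorem sesq_sub (K L : Matrix α α ℂ) : sesq (K - L) = sesq K - sesq L :=
  sesq_form_ext fun i j => by simp

theorem sesq_smul (c : ℂ) (K : Matrix α α ℂ) : sesq (c • K) = c • sesq K :=
  sesq_form_ext fun i j => by simp

theorem sesq_submatrix (K : Matrix β β ℂ) (f : α → β) (x y : α →₀ ℂ) :
    sesq (K.submatrix f f) x y =
      sesq K (Finsupp.lmapDomain ℂ ℂ f x) (Finsupp.lmapDomain ℂ ℂ f y) := by
  have : sesq (K.submatrix f f) =
      ((sesq K).comp (Finsupp.lmapDomain ℂ ℂ f)).compl₂ (Finsupp.lmapDomain ℂ ℂ f) :=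
    sesq_form_ext fun i j => by simp
  rw [this]; rfl

theorem conj_sesq {K : Matrix α α ℂ} (hK : K.IsHermitian) (x y : α →₀ ℂ) :
    conj (sesq K x y) = sesq K y x := by
  simp only [sesq_apply, map_finsuppSum]
  rw [Finsupp.sum_comm]
  congr! 6 with j b i a
  rw [← hK.apply]
  simp
  ring

theorem sesq_self_nonneg {K : Matrix α α ℂ} (hK : K.PosSemidef) (x : α →₀ ℂ) :
    0 ≤ sesq K x x := hK.2 x

theorem sesq_self_re_nonneg {K : Matrix α α ℂ} (hK : K.PosSemidef) (x : α →₀ ℂ) :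
    0 ≤ (sesq K x x).re := (Complex.le_def.1 (sesq_self_nonneg hK x)).1

theorem posSemidef_of_re_nonneg {K : Matrix α α ℂ} (hK : K.IsHermitian)
    (h : ∀ x, 0 ≤ (sesq K x x).re) : K.PosSemidef :=
  ⟨hK, fun x => Complex.le_def.2 ⟨h x, (Complex.conj_eq_iff_im.1 (conj_sesq hK x x)).symm⟩⟩

/-- Pointwise limits of positive semidefinite kernels are positive semidefinite. -/
theorem posSemidef_of_tendsto {K : ℕ → Matrix α α ℂ} {L : Matrix α α ℂ}
    (hK : ∀ n, (K n).PosSemidef) (h : ∀ i j, Tendsto (fun n => K n i j) atTop (𝓝 (L i j))) :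
    L.PosSemidef := by
  refine posSemidef_of_re_nonneg ?_ fun x => ?_
  · ext i j
    refine tendsto_nhds_unique ?_ (h i j)
    have := (h j i).star
    simpa [(hK _).1.apply] using this
  · have : Tendsto (fun n => (sesq (K n) x x).re) atTop (𝓝 (sesq L x x).re) := by
      refine (Complex.continuous_re.tendsto _).comp ?_
      simp only [sesq_apply, Finsupp.sum]
      exact tendsto_finsetSum _ fun i _ => tendsto_finsetSum _ fun j _ =>
        ((h i j).const_mul _).mul_const _
    exact ge_of_tendsto' this fun n => sesq_self_re_nonneg (hK n) x

/-- **Kolmogorov decomposition**: a positive semidefinite kernel is the Gram kernel of a family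
spanning a dense subspace of a Hilbert space. The family is recorded through the linear map `E`
it induces on finitely supported vectors. -/
theorem exists_kolmogorov {α : Type u} {K : Matrix α α ℂ} (hK : K.PosSemidef) :
    ∃ (H : Type u) (_ : NormedAddCommGroup H) (_ : InnerProductSpace ℂ H) (_ : CompleteSpace H)
      (E : (α →₀ ℂ) →ₗ[ℂ] H), DenseRange E ∧ ∀ x y, inner ℂ (E x) (E y) = sesq K x y := by
  let core : PreInnerProductSpace.Core ℂ (α →₀ ℂ) :=
    { inner := fun x y => sesq K x y
      conj_inner_symm := fun x y => conj_sesq hK.1 y x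
      re_inner_nonneg := fun x => sesq_self_re_nonneg hK x
      add_left := fun x y z => by simp
      smul_left := fun x y c => by simp }
  let _ : SeminormedAddCommGroup (α →₀ ℂ) :=
    InnerProductSpace.Core.toSeminormedAddCommGroup (𝕜 := ℂ)
  let _ : InnerProductSpace ℂ (α →₀ ℂ) := .ofCore core
  refine ⟨UniformSpace.Completion (α →₀ ℂ), inferInstance, inferInstance, inferInstance,
    (UniformSpace.Completion.toComplL (𝕜 := ℂ) (E := α →₀ ℂ)).toLinearMap,
    UniformSpace.Completion.denseRange_coe, fun x y => ?_⟩
  exact UniformSpace.Completion.inner_coe x y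

end

/-! ### Almost fixed points of uniformly bounded actions -/

section

/-- Let `G` act linearly and uniformly boundedly for the Hilbert seminorm `‖L ·‖` on `E`. A nonempty
invariant set that is closed under midpoints contains a Cauchy sequence that is asymptotically fixed
by every group element.

The function `q X = sup_g ‖L (g X)‖²` is invariant, and the parallelogram identity for each `g`
makes it uniformly convex, so a sequence minimizing `q` on the set has the required properties. -/
theorem exists_cauchySeq_almost_fixed {G E H : Type*} [Group G] [AddCommGroup E] [Module ℂ E]
    [NormedAddCommGroup H] [InnerProductSpace ℂ H] (L : E →ₗ[ℂ] H) (ρ : G →* Module.End ℂ E)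
    (M : ℝ) (hM : ∀ g X, ‖L (ρ g X)‖ ^ 2 ≤ M * ‖L X‖ ^ 2) (C : Set E) (hne : C.Nonempty)
    (hmid : ∀ X ∈ C, ∀ Y ∈ C, (2⁻¹ : ℂ) • (X + Y) ∈ C) (hinv : ∀ g, ∀ X ∈ C, ρ g X ∈ C) :
    ∃ X : ℕ → E, (∀ n, X n ∈ C) ∧ CauchySeq (fun n => L (X n)) ∧
      ∀ g, Tendsto (fun n => L (ρ g (X n)) - L (X n)) atTop (𝓝 0) := by
  wlog hM0 : 0 < M generalizing M
  · exact this 1 (fun g X => (hM g X).trans (by nlinarith [sq_nonneg ‖L X‖])) one_pos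
  set q : E → ℝ := fun X => ⨆ g, ‖L (ρ g X)‖ ^ 2 with hq
  have hbdd : ∀ X, BddAbove (Set.range fun g => ‖L (ρ g X)‖ ^ 2) := fun X =>
    ⟨M * ‖L X‖ ^ 2, by rintro _ ⟨g, rfl⟩; exact hM g X⟩
  have hle : ∀ g X, ‖L (ρ g X)‖ ^ 2 ≤ q X := fun g X => le_ciSup (hbdd X) g
  have hq0 : ∀ X, 0 ≤ q X := fun X => (sq_nonneg _).trans (hle 1 X)
  have hqinv : ∀ g X, q (ρ g X) ≤ q X := fun g X => ciSup_le fun h => by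
    have := hle (h * g) X
    rwa [map_mul] at this
  have hconv : ∀ X Y, ‖L X - L Y‖ ^ 2 ≤
      4 * M * ((q X + q Y) / 2 - q ((2⁻¹ : ℂ) • (X + Y))) := by
    intro X Y
    have key : q ((2⁻¹ : ℂ) • (X + Y)) ≤ (q X + q Y) / 2 - ‖L X - L Y‖ ^ 2 / (4 * M) := by
      refine ciSup_le fun g => ?_
      have hp := parallelogram_law_with_norm ℂ (L (ρ g X)) (L (ρ g Y))
      have h1 : ‖L X - L Y‖ ^ 2 ≤ M * ‖L (ρ g X) - L (ρ g Y)‖ ^ 2 := by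
        have := hM g⁻¹ (ρ g (X - Y))
        rw [← Module.End.mul_apply, ← map_mul] at this
        simpa using this
      have h2 : ‖L (ρ g ((2⁻¹ : ℂ) • (X + Y)))‖ ^ 2 =
          ‖L (ρ g X) + L (ρ g Y)‖ ^ 2 / 4 := by
        simp only [map_smul, map_add, norm_smul, mul_pow]
        norm_num
        ring
      have h3 : ‖L X - L Y‖ ^ 2 / (4 * M) ≤ ‖L (ρ g X) - L (ρ g Y)‖ ^ 2 / 4 := by
        rw [div_le_div_iff₀ (by positivity) (by norm_num)]
        nlinarith
      rw [h2]
      nlinarith [hle g X, hle g Y]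
    have : ‖L X - L Y‖ ^ 2 / (4 * M) ≤ (q X + q Y) / 2 - q ((2⁻¹ : ℂ) • (X + Y)) := by linarith
    rwa [div_le_iff₀' (by positivity)] at this
  set d : ℝ := sInf (q '' C) with hd
  have hdle : ∀ X ∈ C, d ≤ q X := fun X hX =>
    csInf_le ⟨0, by rintro _ ⟨Y, -, rfl⟩; exact hq0 Y⟩ ⟨X, hX, rfl⟩
  have hex : ∀ n : ℕ, ∃ X ∈ C, q X < d + 1 / ((n : ℝ) + 1) := fun n => by
    obtain ⟨_, ⟨X, hX, rfl⟩, h⟩ := exists_lt_of_csInf_lt (hne.image q)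
      (show sInf (q '' C) < d + 1 / ((n : ℝ) + 1) from lt_add_of_pos_right _ (by positivity))
    exact ⟨X, hX, h⟩
  choose X hXC hX using hex
  have hclose : ∀ (n : ℕ), ∀ Y ∈ C, q Y ≤ d + 1 / ((n : ℝ) + 1) →
      ‖L (X n) - L Y‖ ≤ √(4 * M * (1 / ((n : ℝ) + 1))) := fun n Y hY hYq => by
    refine Real.le_sqrt_of_sq_le ((hconv _ _).trans ?_)
    gcongr
    linarith [hdle _ (hmid _ (hXC n) _ hY), hX n]
  have hlim : Tendsto (fun n : ℕ => √(4 * M * (1 / ((n : ℝ) + 1)))) atTop (𝓝 0) := by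
    have := ((tendsto_one_div_add_atTop_nhds_zero_nat (𝕜 := ℝ)).const_mul (4 * M)).sqrt
    simpa using this
  refine ⟨X, hXC, ?_, fun g => ?_⟩
  · refine cauchySeq_of_le_tendsto_0' _ (fun n m hnm => ?_) hlim
    rw [dist_eq_norm]
    refine hclose n _ (hXC m) ((hX m).le.trans ?_)
    gcongr
  · refine squeeze_zero_norm (fun n => ?_) hlim
    rw [norm_sub_rev]
    exact hclose n _ (hinv g _ (hXC n)) ((hqinv g _).trans (hX n).le)

end

/-! ### Negative orthonormal families -/

section

variable {G : Type*} [Group G]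

/-- The kernel `(g, h) ↦ φ(g⁻¹h)` on the whole group. -/
def groupKernel (φ : G → ℂ) : Matrix G G ℂ := Matrix.of fun g h => φ (g⁻¹ * h)

@[simp]
theorem groupKernel_apply (φ : G → ℂ) (g h : G) : groupKernel φ g h = φ (g⁻¹ * h) := rfl

theorem HermitianSymm.isHermitian_groupKernel {φ : G → ℂ} (h : HermitianSymm φ) :
    (groupKernel φ).IsHermitian := by
  ext i j
  rw [Matrix.conjTranspose_apply, groupKernel_apply, groupKernel_apply, ← starRingEnd_apply,
    ← h]
  simp

/-- The permutation representation of `G` on finitely supported functions on a `G`-set,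
`δ_x ↦ δ_{kx}`. -/
noncomputable def translate {α : Type*} [MulAction G α] : G →* Module.End ℂ (α →₀ ℂ) where
  toFun k := Finsupp.lmapDomain ℂ ℂ (k • ·)
  map_one' := by ext; simp
  map_mul' k l := by ext; simp [mul_smul]

theorem translate_def {α : Type*} [MulAction G α] (k : G) :
    translate k = Finsupp.lmapDomain ℂ ℂ fun x : α => k • x := rfl

@[simp]
theorem translate_single {α : Type*} [MulAction G α] (k : G) (x : α) (a : ℂ) :
    translate k (Finsupp.single x a) = Finsupp.single (k • x) a := by
  simp [translate_def]

theorem sesq_groupKernel_translate (φ : G → ℂ) (k : G) (x y : G →₀ ℂ) :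
    sesq (groupKernel φ) (translate k x) (translate k y) = sesq (groupKernel φ) x y := by
  rw [translate_def, ← sesq_submatrix]
  congr 3
  ext g h
  simp [mul_assoc]

/-- The form of a Hermitian matrix in the coordinates of an orthonormal eigenbasis. -/
theorem sesq_eq_sum_eigenvalues {n : ℕ} {A : Matrix (Fin n) (Fin n) ℂ} (hA : A.IsHermitian)
    (c : Fin n →₀ ℂ) : sesq A c c = ∑ l, (hA.eigenvalues l : ℂ) *
      (‖(star (hA.eigenvectorBasis l).ofLp) ⬝ᵥ ⇑c‖ ^ 2 : ℝ) := by
  have h1 : sesq A c c = inner ℂ (WithLp.toLp 2 ⇑c) (WithLp.toLp 2 (A.mulVec ⇑c)) := by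
    rw [EuclideanSpace.inner_toLp_toLp, sesq_apply]
    simp only [dotProduct, Matrix.mulVec, Finsupp.sum_fintype, zero_mul, mul_zero, star_zero,
      implies_true, Finset.sum_const_zero, Pi.star_apply, Finset.sum_mul]
    congr! 2 with i _ j _
    ring
  rw [h1, ← hA.eigenvectorBasis.sum_inner_mul_inner]
  congr! 1 with l
  have h2 : inner ℂ (hA.eigenvectorBasis l) (WithLp.toLp 2 ⇑c) =
      star (hA.eigenvectorBasis l).ofLp ⬝ᵥ ⇑c := by
    rw [EuclideanSpace.inner_eq_star_dotProduct, dotProduct_comm]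
  have h3 : inner ℂ (hA.eigenvectorBasis l) (WithLp.toLp 2 (A.mulVec ⇑c)) =
      (hA.eigenvalues l : ℂ) * (star (hA.eigenvectorBasis l).ofLp ⬝ᵥ ⇑c) := by
    rw [EuclideanSpace.inner_eq_star_dotProduct, dotProduct_comm]
    simp only
    rw [Matrix.dotProduct_mulVec]
    have := congrArg star (hA.mulVec_eigenvectorBasis l)
    rw [Matrix.star_mulVec, hA.eq] at this
    rw [this]
    simp
  rw [h3, ← h2, ← inner_conj_symm (WithLp.toLp 2 ⇑c)]
  rw [mul_left_comm, Complex.conj_mul']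
  push_cast
  rfl

/-- One half of Sylvester's law of inertia: a family that is orthonormal for the opposite of the
form has at most as many members as there are negative eigenvalues. -/
theorem le_of_negative_orthonormal {φ : G → ℂ} (h : HermitianSymm φ) {k : ℕ}
    (hk : ∀ (n : ℕ) (g : Fin n → G),
      (Finset.univ.filter fun i => (h.isHermitian g).eigenvalues i < 0).card ≤ k)
    {m : ℕ} (f : Fin m → G →₀ ℂ)
    (hf : ∀ i j, sesq (groupKernel φ) (f i) (f j) = if i = j then -1 else 0) : m ≤ k := by
  classical
  by_contra! hkm
  set s : Finset G := Finset.univ.biUnion fun i => (f i).support with hs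
  set g : Fin s.card → G := fun i => (s.equivFin.symm i : G) with hg
  have hginj : Function.Injective g :=
    Subtype.val_injective.comp s.equivFin.symm.injective
  have hgrange : ∀ i, ((f i).support : Set G) ⊆ Set.range g := fun i x hx =>
    ⟨s.equivFin ⟨x, Finset.mem_biUnion.2 ⟨i, Finset.mem_univ _, hx⟩⟩, by simp [g]⟩
  set c : Fin m → Fin s.card →₀ ℂ := fun i => (f i).comapDomain g hginj.injOn with hc
  have hcf : ∀ i, Finsupp.lmapDomain ℂ ℂ g (c i) = f i := fun i =>
    Finsupp.mapDomain_comapDomain g hginj (f i) (hgrange i)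
  set A := kernelMatrix φ g with hA
  have hAK : A = (groupKernel φ).submatrix g g := rfl
  set hH : A.IsHermitian := h.isHermitian g
  let comb : (Fin m → ℂ) →ₗ[ℂ] (Fin s.card →₀ ℂ) := Fintype.linearCombination ℂ c
  -- the coordinates of a combination of the family along the eigenvectors with negative eigenvalue
  let coord : (Fin m → ℂ) →ₗ[ℂ] ({l // hH.eigenvalues l < 0} → ℂ) :=
    LinearMap.pi fun l =>
      (dotProductBilin ℂ ℂ (star (hH.eigenvectorBasis l.1).ofLp)).comp
        (Finsupp.lcoeFun.comp comb)
  have hker : LinearMap.ker coord ≠ ⊥ := by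
    refine LinearMap.ker_ne_bot_of_finrank_lt ?_
    rw [Module.finrank_fintype_fun_eq_card, Module.finrank_fintype_fun_eq_card, Fintype.card_fin,
      Fintype.card_subtype]
    exact (hk _ g).trans_lt hkm
  obtain ⟨a, ha, ha0⟩ := (Submodule.ne_bot_iff _).1 hker
  have h1 : 0 ≤ (sesq A (comb a) (comb a)).re := by
    rw [sesq_eq_sum_eigenvalues hH, Complex.re_sum]
    refine Finset.sum_nonneg fun l _ => ?_
    rw [Complex.re_ofReal_mul, Complex.ofReal_re]
    by_cases hl : hH.eigenvalues l < 0
    · have := congrFun (LinearMap.mem_ker.1 ha) ⟨l, hl⟩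
      have h0 : star (hH.eigenvectorBasis l).ofLp ⬝ᵥ ⇑(comb a) = 0 := this
      simp [h0]
    · exact mul_nonneg (not_lt.1 hl) (sq_nonneg _)
  have h2 : sesq A (comb a) (comb a) = -∑ i, ((‖a i‖ ^ 2 : ℝ) : ℂ) := by
    have : Finsupp.lmapDomain ℂ ℂ g (comb a) = ∑ i, a i • f i := by
      simp only [comb, Fintype.linearCombination_apply, map_sum, map_smul, hcf]
    rw [hAK, sesq_submatrix, this]
    simp only [map_sum, map_smulₛₗ, LinearMap.sum_apply, LinearMap.smul_apply, hf, smul_eq_mul,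
      RingHom.id_apply, mul_ite, mul_zero, Finset.sum_ite_eq',
      Finset.mem_univ, if_true]
    rw [← Finset.sum_neg_distrib]
    congr! 1 with i
    rw [mul_neg, mul_one, mul_neg, Complex.mul_conj']
    push_cast
    rfl
  rw [h2] at h1
  have h3 : ∑ i, ‖a i‖ ^ 2 ≤ 0 := by
    rw [← Complex.ofReal_sum, Complex.neg_re, Complex.ofReal_re] at h1
    linarith
  refine ha0 (funext fun i => ?_)
  have := (Finset.sum_eq_zero_iff_of_nonneg (fun i _ => sq_nonneg ‖a i‖)).1
    (le_antisymm h3 (Finset.sum_nonneg fun i _ => sq_nonneg _)) i (Finset.mem_univ i)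
  simpa using this

/-- A maximal negative orthonormal family `n`: reversing the sign of the form on its span yields
a positive semidefinite form. In fact the form is already nonnegative after its part along the
span is removed. -/
theorem IsQPD.exists_maximal_negative {φ : G → ℂ} (hφ : IsQPD φ) :
    ∃ (m : ℕ) (n : Fin m → G →₀ ℂ),
      (∀ i j, sesq (groupKernel φ) (n i) (n j) = if i = j then -1 else 0) ∧
      ∀ y, 0 ≤ (sesq (groupKernel φ) y y).re + ∑ i, ‖sesq (groupKernel φ) (n i) y‖ ^ 2 := by
  obtain ⟨h, k, hk⟩ := hφ
  set B := sesq (groupKernel φ) with hB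
  have hconj : ∀ x y, conj (B x y) = B y x := conj_sesq h.isHermitian_groupKernel
  have hmax : ∃ m : ℕ, (∃ n : Fin m → G →₀ ℂ, ∀ i j, B (n i) (n j) = if i = j then -1 else 0) ∧
      ¬ ∃ n : Fin (m + 1) → G →₀ ℂ, ∀ i j, B (n i) (n j) = if i = j then -1 else 0 := by
    by_contra! hcon
    have : ∀ m : ℕ, ∃ n : Fin m → G →₀ ℂ, ∀ i j, B (n i) (n j) = if i = j then -1 else 0 := by
      intro m
      induction m with
      | zero => exact ⟨Fin.elim0, fun i => i.elim0⟩
      | succ m ih => exact hcon m ih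
    obtain ⟨n, hn⟩ := this (k + 1)
    exact absurd (le_of_negative_orthonormal h hk n hn) (by simp)
  obtain ⟨m, ⟨n, hn⟩, hno⟩ := hmax
  refine ⟨m, n, hn, fun y => ?_⟩
  by_contra! hlt
  set r : ℝ := -((B y y).re + ∑ i, ‖B (n i) y‖ ^ 2) with hr
  have hr0 : 0 < r := by linarith
  -- the component of `y` orthogonal to the family
  set z : G →₀ ℂ := y + ∑ i, B (n i) y • n i with hz
  have hnz : ∀ j, B (n j) z = 0 := fun j => by
    simp [hz, hn]
  have hzn : ∀ j, B z (n j) = 0 := fun j => by rw [← hconj, hnz, map_zero]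
  have hyy : ((B y y).re : ℂ) = B y y := Complex.conj_eq_iff_re.1 (hconj y y)
  have hzz : B z z = -(r : ℂ) := by
    have h1 : B z z = B y z := by
      have h0 : ∀ w, B z w = B y w + ∑ i, conj (B (n i) y) * B (n i) w := fun w => by simp [hz]
      simp [h0 z, hnz]
    have h2 : B y z = B y y + ∑ i, ((‖B (n i) y‖ ^ 2 : ℝ) : ℂ) := by
      simp only [hz, map_add, map_sum, map_smul, smul_eq_mul]
      congr! 2 with i
      rw [← hconj (n i) y, Complex.mul_conj']
      push_cast
      rfl
    rw [h1, h2, hr]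
    push_cast
    rw [hyy]
    ring
  have hsq : ((√r : ℝ) : ℂ) * ((√r : ℝ) : ℂ) = r := by
    rw [← Complex.ofReal_mul, Real.mul_self_sqrt hr0.le]
  have hsq0 : ((√r : ℝ) : ℂ) ≠ 0 := by
    simpa using (Real.sqrt_pos.2 hr0).ne'
  refine hno ⟨Fin.snoc n (((√r : ℝ) : ℂ)⁻¹ • z), fun i j => ?_⟩
  induction i using Fin.lastCases with
  | last =>
    induction j using Fin.lastCases with
    | last =>
      simp only [Fin.snoc_last, map_smulₛₗ, LinearMap.smul_apply, hzz, smul_eq_mul, if_true,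
        RingHom.id_apply, map_inv₀, Complex.conj_ofReal]
      rw [← hsq]
      field_simp
    | cast j => simp [hzn, (Fin.castSucc_lt_last j).ne']
  | cast i =>
    induction j using Fin.lastCases with
    | last => simp [hnz, (Fin.castSucc_lt_last i).ne]
    | cast j => simp [hn]

end

/-! ### The Hilbert majorant and uniform boundedness of translations -/

section

variable {α : Type*} {G : Type*} [Group G]

theorem sesq_rankOne (l : (α →₀ ℂ) →ₗ[ℂ] ℂ) (x y : α →₀ ℂ) :
    sesq (Matrix.of fun i j => conj (l (Finsupp.single i 1)) * l (Finsupp.single j 1)) x y =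
      conj (l x) * l y := by
  let T : (α →₀ ℂ) →ₗ⋆[ℂ] (α →₀ ℂ) →ₗ[ℂ] ℂ :=
    LinearMap.mk₂'ₛₗ (starRingEnd ℂ) (RingHom.id ℂ) (fun x y => conj (l x) * l y)
      (fun x x' y => by simp [add_mul]) (fun c x y => by simp [mul_assoc])
      (fun x y y' => by simp [mul_add]) (fun c x y => by simp [mul_left_comm])
  have : sesq (Matrix.of fun i j => conj (l (Finsupp.single i 1)) * l (Finsupp.single j 1)) = T :=
    sesq_form_ext fun i j => by simp [T]
  rw [this]; rfl

/-- The kernel `(g, h) ↦ ∑ᵢ conj [nᵢ, δ_g] [nᵢ, δ_h]`, where `[·, ·]` is the form of `φ`. For a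
negative orthonormal family it is the form of the projection onto the span of the family, up to
sign. -/
noncomputable def projKernel (φ : G → ℂ) {m : ℕ} (n : Fin m → G →₀ ℂ) : Matrix G G ℂ :=
  Matrix.of fun g h => ∑ i, conj (sesq (groupKernel φ) (n i) (Finsupp.single g 1)) *
    sesq (groupKernel φ) (n i) (Finsupp.single h 1)

theorem sesq_projKernel (φ : G → ℂ) {m : ℕ} (n : Fin m → G →₀ ℂ) (x y : G →₀ ℂ) :
    sesq (projKernel φ n) x y =
      ∑ i, conj (sesq (groupKernel φ) (n i) x) * sesq (groupKernel φ) (n i) y := by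
  have : sesq (projKernel φ n) = ∑ i, sesq (Matrix.of fun g h =>
      conj (sesq (groupKernel φ) (n i) (Finsupp.single g 1)) *
        sesq (groupKernel φ) (n i) (Finsupp.single h 1)) :=
    sesq_form_ext fun i j => by simp [projKernel]
  rw [this]
  simp only [LinearMap.sum_apply]
  congr! 1 with i
  exact sesq_rankOne _ _ _

theorem sesq_projKernel_self (φ : G → ℂ) {m : ℕ} (n : Fin m → G →₀ ℂ) (x : G →₀ ℂ) :
    sesq (projKernel φ n) x x = ((∑ i, ‖sesq (groupKernel φ) (n i) x‖ ^ 2 : ℝ) : ℂ) := by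
  rw [sesq_projKernel]
  push_cast
  simp only [Complex.conj_mul']

theorem isHermitian_projKernel (φ : G → ℂ) {m : ℕ} (n : Fin m → G →₀ ℂ) :
    (projKernel φ n).IsHermitian := by
  ext g h
  simp [projKernel, mul_comm]

theorem posSemidef_projKernel (φ : G → ℂ) {m : ℕ} (n : Fin m → G →₀ ℂ) :
    (projKernel φ n).PosSemidef := by
  refine posSemidef_of_re_nonneg (isHermitian_projKernel φ n) fun x => ?_
  rw [sesq_projKernel_self, Complex.ofReal_re]
  positivity

/-- The fundamental symmetry `v ↦ v + 2 ∑ᵢ [nᵢ, v] nᵢ`: the reflection that turns the form of `φ`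
into the majorant `[x, y] + 2 ∑ᵢ [x, nᵢ] [nᵢ, y]`. -/
noncomputable def fundSymm (φ : G → ℂ) {m : ℕ} (n : Fin m → G →₀ ℂ) (v : G →₀ ℂ) : G →₀ ℂ :=
  v + (2 : ℂ) • ∑ i, sesq (groupKernel φ) (n i) v • n i

/-- The Hilbert majorant of the form of `φ` attached to a negative orthonormal family. -/
noncomputable def majorant (φ : G → ℂ) {m : ℕ} (n : Fin m → G →₀ ℂ) : Matrix G G ℂ :=
  groupKernel φ + projKernel φ n + projKernel φ n

theorem sesq_majorant (φ : G → ℂ) {m : ℕ} (n : Fin m → G →₀ ℂ) (x y : G →₀ ℂ) :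
    sesq (majorant φ n) x y = sesq (groupKernel φ) x y +
      2 * ∑ i, conj (sesq (groupKernel φ) (n i) x) * sesq (groupKernel φ) (n i) y := by
  simp only [majorant, sesq_add, LinearMap.add_apply, sesq_projKernel]
  ring

theorem sesq_majorant_self_re (φ : G → ℂ) {m : ℕ} (n : Fin m → G →₀ ℂ) (x : G →₀ ℂ) :
    (sesq (majorant φ n) x x).re = (sesq (groupKernel φ) x x).re +
      2 * ∑ i, ‖sesq (groupKernel φ) (n i) x‖ ^ 2 := by
  simp only [majorant, sesq_add, LinearMap.add_apply, sesq_projKernel_self, Complex.add_re,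
    Complex.ofReal_re]
  ring

section Family

variable {φ : G → ℂ} {m : ℕ} {n : Fin m → G →₀ ℂ}

theorem posSemidef_groupKernel_add_projKernel (hφ : HermitianSymm φ)
    (hpos : ∀ y, 0 ≤ (sesq (groupKernel φ) y y).re + ∑ i, ‖sesq (groupKernel φ) (n i) y‖ ^ 2) :
    (groupKernel φ + projKernel φ n).PosSemidef := by
  refine posSemidef_of_re_nonneg
    (hφ.isHermitian_groupKernel.add (isHermitian_projKernel φ n)) fun x => ?_
  simpa [sesq_add, sesq_projKernel_self, ← Complex.ofReal_sum, ← Complex.ofReal_pow] using hpos x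

/-- The form of `φ` is the majorant composed with the fundamental symmetry. In particular it is
continuous for the majorant in each variable. -/
theorem sesq_majorant_fundSymm (hφ : HermitianSymm φ)
    (hn : ∀ i j, sesq (groupKernel φ) (n i) (n j) = if i = j then -1 else 0) (v y : G →₀ ℂ) :
    sesq (majorant φ n) (fundSymm φ n v) y = sesq (groupKernel φ) v y := by
  have hconj := conj_sesq hφ.isHermitian_groupKernel
  have h1 : ∀ i, sesq (groupKernel φ) (n i) (fundSymm φ n v) =
      -sesq (groupKernel φ) (n i) v := fun i => by
    simp only [fundSymm, map_add, map_smul, map_sum, hn, smul_eq_mul, mul_ite, mul_zero,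
      Finset.sum_ite_eq, Finset.mem_univ, if_true]
    ring
  rw [sesq_majorant]
  simp only [h1]
  simp only [fundSymm, map_add, map_smulₛₗ, map_sum, LinearMap.add_apply, LinearMap.smul_apply,
    LinearMap.sum_apply, smul_eq_mul, map_neg, neg_mul, Finset.sum_neg_distrib, map_ofNat]
  ring

theorem exists_bound_sesq_translate (hb : ∃ C : ℝ, ∀ g, ‖φ g‖ ≤ C) (x y : G →₀ ℂ) :
    ∃ b : ℝ, ∀ k : G, ‖sesq (groupKernel φ) x (translate k y)‖ ≤ b := by
  induction x using Finsupp.induction_linear with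
  | zero => exact ⟨0, fun k => by simp⟩
  | add x x' hx hx' =>
    obtain ⟨b, hx⟩ := hx
    obtain ⟨b', hx'⟩ := hx'
    exact ⟨b + b', fun k => by
      simpa using (norm_add_le _ _).trans (add_le_add (hx k) (hx' k))⟩
  | single g s =>
    induction y using Finsupp.induction_linear with
    | zero => exact ⟨0, fun k => by simp⟩
    | add y y' hy hy' =>
      obtain ⟨b, hy⟩ := hy
      obtain ⟨b', hy'⟩ := hy'
      exact ⟨b + b', fun k => by
        simpa using (norm_add_le _ _).trans (add_le_add (hy k) (hy' k))⟩
    | single h t =>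
      obtain ⟨C, hC⟩ := hb
      refine ⟨‖s‖ * C * ‖t‖, fun k => ?_⟩
      simp only [translate_single, sesq_single_single, norm_mul, RCLike.norm_conj,
        groupKernel_apply]
      gcongr
      exact hC _

/-- Translations act on the space completed for the majorant by uniformly bounded operators.
Boundedness of `φ` controls them on the negative family, and invariance of the form propagates
this control to all vectors. -/
theorem exists_majorant_translate_le (hφ : HermitianSymm φ)
    (hn : ∀ i j, sesq (groupKernel φ) (n i) (n j) = if i = j then -1 else 0)
    (hpos : ∀ y, 0 ≤ (sesq (groupKernel φ) y y).re + ∑ i, ‖sesq (groupKernel φ) (n i) y‖ ^ 2)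
    (hb : ∃ C : ℝ, ∀ g, ‖φ g‖ ≤ C) :
    ∃ M : ℝ, 0 ≤ M ∧ ∀ (k : G) (y : G →₀ ℂ), (sesq (majorant φ n) (translate k y) (translate k y)).re ≤
      M * (sesq (majorant φ n) y y).re := by
  have hconj := conj_sesq hφ.isHermitian_groupKernel
  have hΘ : (majorant φ n).PosSemidef :=
    (posSemidef_groupKernel_add_projKernel hφ hpos).add (posSemidef_projKernel φ n)
  obtain ⟨H, _, _, _, E, -, hE⟩ := exists_kolmogorov hΘ
  have hEsq : ∀ y, ‖E y‖ ^ 2 = (sesq (majorant φ n) y y).re := fun y => by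
    rw [← hE, ← inner_self_eq_norm_sq (𝕜 := ℂ)]; rfl
  choose b hb using fun i j => exists_bound_sesq_translate hb (n j) (n i)
  set c : ℝ := ∑ i, ∑ j, b i j ^ 2 with hc
  have hJ : ∀ (k : G) i, ‖E (fundSymm φ n (translate k (n i)))‖ ^ 2 ≤ 2 * c := fun k i => by
    set v := translate k (n i) with hv
    have hvv : sesq (groupKernel φ) v v = -1 := by
      rw [hv, sesq_groupKernel_translate, hn, if_pos rfl]
    have h1 : sesq (majorant φ n) (fundSymm φ n v) (fundSymm φ n v) =
        -1 + 2 * ((∑ j, ‖sesq (groupKernel φ) (n j) v‖ ^ 2 : ℝ) : ℂ) := by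
      rw [sesq_majorant_fundSymm hφ hn]
      simp only [fundSymm, map_add, map_smul, map_sum, hvv, smul_eq_mul]
      congr 2
      push_cast
      congr! 1 with j
      rw [← hconj (n j) v, Complex.mul_conj']
    rw [hEsq, h1]
    have h2 : ∑ j, ‖sesq (groupKernel φ) (n j) v‖ ^ 2 ≤ ∑ j, b i j ^ 2 :=
      Finset.sum_le_sum fun j _ => by gcongr; exact hb i j k
    have h3 : ∑ j, b i j ^ 2 ≤ c :=
      Finset.single_le_sum (f := fun i => ∑ j, b i j ^ 2) (fun i _ => by positivity)
        (Finset.mem_univ i)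
    have h4 : (-1 + 2 * ((∑ j, ‖sesq (groupKernel φ) (n j) v‖ ^ 2 : ℝ) : ℂ)).re =
        -1 + 2 * ∑ j, ‖sesq (groupKernel φ) (n j) v‖ ^ 2 := by
      rw [Complex.add_re, ← Complex.ofReal_ofNat, Complex.re_ofReal_mul, Complex.ofReal_re]
      simp
    rw [h4]
    linarith
  refine ⟨1 + 2 * (m * (2 * c)), by positivity, fun k y => ?_⟩
  have hterm : ∀ i, ‖sesq (groupKernel φ) (n i) (translate k y)‖ ^ 2 ≤ 2 * c * ‖E y‖ ^ 2 := by
    intro i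
    have h1 : sesq (groupKernel φ) (n i) (translate k y) =
        inner ℂ (E (fundSymm φ n (translate k⁻¹ (n i)))) (E y) := by
      have h0 : translate k (translate k⁻¹ (n i)) = n i := by
        rw [← Module.End.mul_apply, ← map_mul, mul_inv_cancel, map_one, Module.End.one_apply]
      rw [hE, sesq_majorant_fundSymm hφ hn, ← sesq_groupKernel_translate φ k (translate _ _),
        h0]
    rw [h1]
    calc _ ≤ (‖E (fundSymm φ n (translate k⁻¹ (n i)))‖ * ‖E y‖) ^ 2 := by
          gcongr; exact norm_inner_le_norm _ _
      _ ≤ _ := by rw [mul_pow]; gcongr; exact hJ _ _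
  have hsum : ∑ i, ‖sesq (groupKernel φ) (n i) (translate k y)‖ ^ 2 ≤
      m * (2 * c * ‖E y‖ ^ 2) := by
    simpa using Finset.sum_le_card_nsmul _ _ _ fun i (_ : i ∈ Finset.univ) => hterm i
  have h2 : (sesq (groupKernel φ) y y).re ≤ ‖E y‖ ^ 2 := by
    rw [hEsq, sesq_majorant_self_re]
    have : 0 ≤ ∑ i, ‖sesq (groupKernel φ) (n i) y‖ ^ 2 := by positivity
    linarith
  rw [← hEsq y, sesq_majorant_self_re, sesq_groupKernel_translate]
  linarith

end Family

end

/-! ### Tensors and the invariant dominating kernel -/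

section

variable {α : Type*} {G : Type*} [Group G]

/-- The tensor product of the kernel `A` with the complex conjugate (that is, the transpose) of
`B`. For `A = B` it is the Hilbert–Schmidt inner product on operators of finite rank. -/
def pairKernel (A B : Matrix α α ℂ) : Matrix (α × α) (α × α) ℂ :=
  Matrix.of fun p q => A p.1 q.1 * B q.2 p.2

theorem posSemidef_pairKernel {A B : Matrix α α ℂ} (hA : A.PosSemidef) (hB : B.PosSemidef) :
    (pairKernel A B).PosSemidef :=
  (hA.submatrix Prod.fst).hadamard (hB.transpose.submatrix Prod.snd)

/-- If translations have norm at most `√M` for a kernel, then they have norm at most `M` for the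
Hilbert–Schmidt norm on tensors. -/
theorem sesq_pairKernel_translate_le {K : Matrix G G ℂ} (hK : K.PosSemidef) {M : ℝ} (hM : 0 ≤ M)
    (h : ∀ (k : G) (y : G →₀ ℂ), (sesq K (translate k y) (translate k y)).re ≤
      M * (sesq K y y).re) (k : G) (X : G × G →₀ ℂ) :
    (sesq (pairKernel K K) (translate k X) (translate k X)).re ≤
      M ^ 2 * (sesq (pairKernel K K) X X).re := by
  set A := K.submatrix (k • ·) (k • ·) with hA
  have hAp : A.PosSemidef := hK.submatrix _
  have hMK : ((M : ℂ) • K).PosSemidef := hK.smul (by simpa using hM)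
  have hD : ((M : ℂ) • K - A).PosSemidef := by
    refine posSemidef_of_re_nonneg (hMK.1.sub hAp.1) fun y => ?_
    have := h k y
    rw [sesq_sub, sesq_smul, hA, LinearMap.sub_apply, LinearMap.sub_apply, sesq_submatrix,
      LinearMap.smul_apply, LinearMap.smul_apply, smul_eq_mul, Complex.sub_re,
      Complex.re_ofReal_mul]
    exact sub_nonneg.2 this
  -- `M² K ⊗ Kᵗ - A ⊗ Aᵗ` as a sum of tensor products of positive semidefinite kernels
  have hdecomp : ((M ^ 2 : ℝ) : ℂ) • pairKernel K K - pairKernel A A =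
      pairKernel ((M : ℂ) • K) ((M : ℂ) • K - A) + pairKernel ((M : ℂ) • K - A) A := by
    ext p q
    simp [pairKernel]
    ring
  have hpos := sesq_self_re_nonneg
    ((posSemidef_pairKernel hMK hD).add (posSemidef_pairKernel hD hAp)) X
  rw [← hdecomp, sesq_sub, sesq_smul, LinearMap.sub_apply, LinearMap.sub_apply,
    LinearMap.smul_apply, LinearMap.smul_apply, smul_eq_mul, Complex.sub_re,
    Complex.re_ofReal_mul] at hpos
  have hAX : sesq (pairKernel A A) X X =
      sesq (pairKernel K K) (translate k X) (translate k X) := by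
    rw [translate_def, ← sesq_submatrix]
    rfl
  rw [hAX] at hpos
  linarith

/-- The elementary tensor `x ⊗ conj y`, as a finitely supported function on pairs. -/
noncomputable def conjTensor (x y : α →₀ ℂ) : α × α →₀ ℂ :=
  x.sum fun a s => y.sum fun b t => Finsupp.single (a, b) (s * conj t)

theorem sesq_pairKernel_conjTensor (A B : Matrix α α ℂ) (x y : α →₀ ℂ) (a b : α) :
    sesq (pairKernel A B) (conjTensor x y) (Finsupp.single (a, b) 1) =
      sesq A x (Finsupp.single a 1) * sesq B (Finsupp.single b 1) y := by
  rw [sesq_single_right A, sesq_single_left B]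
  simp only [conjTensor, Finsupp.sum, map_sum, LinearMap.sum_apply, sesq_single_single]
  rw [Finset.sum_mul_sum]
  refine Finset.sum_congr rfl fun i _ => Finset.sum_congr rfl fun j _ => ?_
  simp [pairKernel]
  ring

/-- The kernel `(g, h) ↦ ⟨Jδ_g ⊗ conj Jδ_h, X⟩` represented by a tensor `X`, where `J` turns the
majorant into the form of `φ`; explicitly, `δ_a ⊗ conj δ_b` is sent to
`(g, h) ↦ φ(g⁻¹a) φ(b⁻¹h)`. -/
noncomputable def tensorKernel (φ : G → ℂ) : (G × G →₀ ℂ) →ₗ[ℂ] Matrix G G ℂ :=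
  Finsupp.linearCombination ℂ fun p => Matrix.of fun g h => φ (g⁻¹ * p.1) * φ (p.2⁻¹ * h)

theorem tensorKernel_conjTensor (φ : G → ℂ) (x y : G →₀ ℂ) (g h : G) :
    tensorKernel φ (conjTensor x y) g h =
      sesq (groupKernel φ) (Finsupp.single g 1) x * sesq (groupKernel φ) y (Finsupp.single h 1) := by
  rw [sesq_single_right, sesq_single_left]
  simp only [conjTensor, Finsupp.sum, map_sum, tensorKernel, Finsupp.linearCombination_single,
    Matrix.sum_apply, Matrix.smul_apply, Matrix.of_apply]
  rw [Finset.sum_mul_sum]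
  refine Finset.sum_congr rfl fun i _ => Finset.sum_congr rfl fun j _ => ?_
  simp
  ring

theorem tensorKernel_translate (φ : G → ℂ) (k : G) (X : G × G →₀ ℂ) :
    tensorKernel φ (translate k X) =
      (tensorKernel φ X).submatrix (k⁻¹ * ·) (k⁻¹ * ·) := by
  induction X using Finsupp.induction_linear with
  | zero => simp
  | add X Y hX hY => simp [hX, hY, Matrix.submatrix_add]
  | single p c =>
    ext g h
    simp [tensorKernel, mul_assoc]

/-- A bounded quasi-positive definite function becomes positive definite after a positive definite
function is added. The second function comes from an invariant limit of tensors whose kernel `P`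
satisfies `0 ≤ P` and `0 ≤ φ + P`. -/
theorem IsQPD.exists_dominating {φ : G → ℂ} (hφ : IsQPD φ) (hb : ∃ C : ℝ, ∀ g, ‖φ g‖ ≤ C) :
    ∃ ψ : G → ℂ, (groupKernel ψ).PosSemidef ∧ (groupKernel φ + groupKernel ψ).PosSemidef := by
  obtain ⟨m, n, hn, hpos⟩ := hφ.exists_maximal_negative
  have hH := hφ.1
  have hconj := conj_sesq hH.isHermitian_groupKernel
  have hΘ : (majorant φ n).PosSemidef :=
    (posSemidef_groupKernel_add_projKernel hH hpos).add (posSemidef_projKernel φ n)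
  obtain ⟨M, hM0, hM⟩ := exists_majorant_translate_le hH hn hpos hb
  obtain ⟨H, _, _, _, E, -, hE⟩ := exists_kolmogorov (posSemidef_pairKernel hΘ hΘ)
  have hEsq : ∀ X, ‖E X‖ ^ 2 =
      (sesq (pairKernel (majorant φ n) (majorant φ n)) X X).re := fun X => by
    rw [← hE, ← inner_self_eq_norm_sq (𝕜 := ℂ)]; rfl
  set C : Set (G × G →₀ ℂ) := {X | (tensorKernel φ X).PosSemidef ∧
    (groupKernel φ + tensorKernel φ X).PosSemidef} with hC
  have hne : C.Nonempty := by
    have : tensorKernel φ (∑ i, conjTensor (n i) (n i)) = projKernel φ n := by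
      ext g h
      simp [Matrix.sum_apply, tensorKernel_conjTensor, projKernel, hconj]
    refine ⟨∑ i, conjTensor (n i) (n i), ?_, ?_⟩ <;> rw [this]
    · exact posSemidef_projKernel φ n
    · exact posSemidef_groupKernel_add_projKernel hH hpos
  have hhalf : (0 : ℂ) ≤ 2⁻¹ := by norm_num [Complex.le_def]
  obtain ⟨X, hXC, hcau, hfix⟩ := exists_cauchySeq_almost_fixed E translate (M ^ 2)
    (fun k X => by
      rw [hEsq, hEsq]
      exact sesq_pairKernel_translate_le hΘ hM0 hM k X) C hne
    (fun X hX Y hY => by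
      refine ⟨?_, ?_⟩
      · rw [map_smul, map_add]
        exact (hX.1.add hY.1).smul hhalf
      · have : groupKernel φ + tensorKernel φ ((2⁻¹ : ℂ) • (X + Y)) =
            (2⁻¹ : ℂ) • ((groupKernel φ + tensorKernel φ X) +
              (groupKernel φ + tensorKernel φ Y)) := by
          rw [map_smul, map_add]
          module
        rw [this]
        exact (hX.2.add hY.2).smul hhalf)
    (fun k X hX => by
      have : groupKernel φ = (groupKernel φ).submatrix (k⁻¹ * ·) (k⁻¹ * ·) := by
        ext g h
        simp [mul_assoc]
      refine ⟨?_, ?_⟩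
      · rw [tensorKernel_translate]
        exact hX.1.submatrix _
      · rw [tensorKernel_translate, this]
        exact hX.2.submatrix _)
  obtain ⟨t, ht⟩ := cauchySeq_tendsto_of_complete hcau
  -- the coefficients of the kernel are continuous in the Hilbert–Schmidt norm
  set w : G → G → G × G →₀ ℂ := fun g h =>
    conjTensor (fundSymm φ n (Finsupp.single g 1)) (fundSymm φ n (Finsupp.single h 1)) with hw
  have hev : ∀ X g h, tensorKernel φ X g h = inner ℂ (E (w g h)) (E X) := by
    intro X g h
    rw [hE]
    induction X using Finsupp.induction_linear with
    | zero => simp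
    | add X Y hX hY => simp [hX, hY]
    | single p c =>
      have h1 : Finsupp.single p c = c • Finsupp.single (p.1, p.2) (1 : ℂ) := by simp
      rw [h1, map_smul, map_smul, hw, sesq_pairKernel_conjTensor,
        sesq_majorant_fundSymm hH hn, ← conj_sesq hΘ.1, sesq_majorant_fundSymm hH hn, hconj]
      simp [tensorKernel]
  set P : Matrix G G ℂ := Matrix.of fun g h => inner ℂ (E (w g h)) t with hP
  have hlim : ∀ g h, Tendsto (fun j => tensorKernel φ (X j) g h) atTop (𝓝 (P g h)) := by
    intro g h
    simp only [hev]
    exact tendsto_const_nhds.inner ht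
  have hinv : ∀ k g h, P (k * g) (k * h) = P g h := by
    intro k g h
    refine tendsto_nhds_unique (hlim _ _) ?_
    have h1 : Tendsto (fun j => E (translate k⁻¹ (X j))) atTop (𝓝 t) := by
      simpa using (hfix k⁻¹).add ht
    have h2 : Tendsto (fun j => tensorKernel φ (translate k⁻¹ (X j)) g h) atTop (𝓝 (P g h)) := by
      simp only [hev]
      exact tendsto_const_nhds.inner h1
    simpa [tensorKernel_translate] using h2
  have hPψ : groupKernel (fun g => P 1 g) = P := by
    ext g h
    have := hinv g⁻¹ g h
    rw [inv_mul_cancel] at this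
    exact this
  refine ⟨fun g => P 1 g, ?_, ?_⟩ <;> rw [hPψ]
  · exact posSemidef_of_tendsto (fun j => (hXC j).1) hlim
  · exact posSemidef_of_tendsto (fun j => (hXC j).2) fun g h => (hlim g h).const_add _

end

/-! ### Unitary representations and the spectral decomposition -/

section

variable {G : Type*} [Group G]

theorem isPD_of_inner {V : Type*} [NormedAddCommGroup V] [InnerProductSpace ℂ V]
    (U : G →* (V →L[ℂ] V)) (hU : ∀ g x y, inner ℂ (U g x) (U g y) = inner ℂ x y) (v : V) :
    IsPD fun g => inner ℂ v (U g v) := by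
  have key : ∀ g h, inner ℂ v (U (g⁻¹ * h) v) = inner ℂ (U g v) (U h v) := fun g h => by
    rw [← hU g v, ← mul_apply_eq_comp, ← map_mul, mul_inv_cancel_left]
  refine ⟨fun g => ?_, fun n g => ?_⟩
  · have := key g 1
    simp only [mul_one, map_one, one_apply_eq_self] at this
    exact this.trans (inner_conj_symm _ _).symm
  · have : kernelMatrix (fun g => inner ℂ v (U g v)) g = Matrix.gram ℂ fun i => U (g i) v := by
      ext i j
      exact key _ _
    rw [this]
    exact Matrix.posSemidef_gram ℂ _

/-- Coefficients of a unitary representation at a vector of a finite-dimensional invariant subspace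
`R` are of finite type. The representation on `R` is carried over to a Euclidean space, which lives
in the lowest universe. -/
theorem isPDFiniteType_of_inner {V : Type*} [NormedAddCommGroup V] [InnerProductSpace ℂ V]
    (U : G →* (V →L[ℂ] V)) (hU : ∀ g x y, inner ℂ (U g x) (U g y) = inner ℂ x y)
    (R : Submodule ℂ V) [FiniteDimensional ℂ R] (hR : ∀ g, ∀ x ∈ R, U g x ∈ R) {v : V}
    (hv : v ∈ R) : IsPDFiniteType fun g => inner ℂ v (U g v) := by
  refine ⟨isPD_of_inner U hU v, ?_⟩
  have hinv : ∀ g x, U g (U g⁻¹ x) = x := fun g x => by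
    rw [← mul_apply_eq_comp, ← map_mul, mul_inv_cancel, map_one, one_apply_eq_self]
  let b := (stdOrthonormalBasis ℂ R).repr
  let π : G → (R ≃ₗᵢ[ℂ] R) := fun g =>
    { toFun := fun x => ⟨U g x, hR g x x.2⟩
      invFun := fun x => ⟨U g⁻¹ x, hR g⁻¹ x x.2⟩
      map_add' := fun x y => by ext; simp
      map_smul' := fun c x => by ext; simp
      left_inv := fun x => by ext; simpa using hinv g⁻¹ x
      right_inv := fun x => by ext; exact hinv g x
      norm_map' := fun x => by
        change ‖U g x‖ = ‖(x : V)‖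
        rw [← sq_eq_sq₀ (norm_nonneg _) (norm_nonneg _), ← inner_self_eq_norm_sq (𝕜 := ℂ), hU,
          inner_self_eq_norm_sq] }
  refine ⟨EuclideanSpace ℂ (Fin (Module.finrank ℂ R)), inferInstance, inferInstance,
    inferInstance,
    { toFun := fun g => (b.symm.trans (π g)).trans b
      map_one' := ?_
      map_mul' := fun g h => ?_ }, b ⟨v, hv⟩, fun g => ?_⟩
  · ext1 x
    have : π 1 (b.symm x) = b.symm x := by ext; simp [π]
    simp [this]
  · ext1 x
    have : π (g * h) (b.symm x) = π g (π h (b.symm x)) := by ext; simp [π]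
    simp [this]
  · change _ = inner ℂ (b ⟨v, hv⟩) (b (π g (b.symm (b ⟨v, hv⟩))))
    rw [LinearIsometryEquiv.inner_map_map, LinearIsometryEquiv.symm_apply_apply]
    rfl

/-- A `G`-invariant kernel yields a representation of `G` by unitary operators on its Kolmogorov
space, extending the translations. -/
theorem exists_unitary_extension {H : Type*} [NormedAddCommGroup H] [InnerProductSpace ℂ H]
    [CompleteSpace H] {E : (G →₀ ℂ) →ₗ[ℂ] H} (hd : DenseRange E)
    (hE : ∀ (k : G) x y, inner ℂ (E (translate k x)) (E (translate k y)) = inner ℂ (E x) (E y)) :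
    ∃ U : G →* (H →L[ℂ] H), (∀ k y, U k (E y) = E (translate k y)) ∧
      ∀ k x y, inner ℂ (U k x) (U k y) = inner ℂ x y := by
  have hn : ∀ (k : G) y, ‖(E ∘ₗ translate k) y‖ ≤ 1 * ‖E y‖ := fun k y => by
    rw [one_mul, LinearMap.comp_apply, ← sq_le_sq₀ (norm_nonneg _) (norm_nonneg _),
      ← inner_self_eq_norm_sq (𝕜 := ℂ), hE, inner_self_eq_norm_sq]
  have hext : ∀ (k : G) y, (E ∘ₗ translate k).extendOfNorm E (E y) = E (translate k y) :=
    fun k y => LinearMap.extendOfNorm_eq hd ⟨1, hn k⟩ y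
  refine ⟨{ toFun := fun k => (E ∘ₗ translate k).extendOfNorm E
            map_one' := ?_
            map_mul' := fun k l => ?_ }, hext, fun k x y => ?_⟩
  · refine ContinuousLinearMap.ext fun x => ?_
    refine congrFun (hd.equalizer (ContinuousLinearMap.continuous _)
      (ContinuousLinearMap.continuous _) (funext fun y => ?_)) x
    change (E ∘ₗ translate (1 : G)).extendOfNorm E (E y) = E y
    rw [hext, map_one, Module.End.one_apply]
  · refine ContinuousLinearMap.ext fun x => ?_
    refine congrFun (hd.equalizer (ContinuousLinearMap.continuous _)
      (ContinuousLinearMap.continuous _) (funext fun y => ?_)) x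
    change (E ∘ₗ translate (k * l)).extendOfNorm E (E y) =
      (E ∘ₗ translate k).extendOfNorm E ((E ∘ₗ translate l).extendOfNorm E (E y))
    rw [hext, hext, hext, map_mul, Module.End.mul_apply]
  · change inner ℂ ((E ∘ₗ translate k).extendOfNorm E x) ((E ∘ₗ translate k).extendOfNorm E y) = _
    refine hd.induction_on₂ (isClosed_eq (by fun_prop) (by fun_prop)) (fun a b => ?_) x y
    rw [hext, hext, hE]

/-- On the Kolmogorov space of `K + 2P`, where `P` and `K + P` are positive semidefinite, the form
of `K` is bounded and represented by a self-adjoint operator: it is `1 - 2 V†V` for the contraction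
`V` onto the Kolmogorov space of `P`. -/
theorem exists_selfAdjoint_representing {α : Type*} {H : Type*} [NormedAddCommGroup H]
    [InnerProductSpace ℂ H] [CompleteSpace H] {E : (α →₀ ℂ) →ₗ[ℂ] H} (hd : DenseRange E)
    {K P : Matrix α α ℂ} (hP : P.PosSemidef) (hKP : (K + P).PosSemidef)
    (hE : ∀ x y, inner ℂ (E x) (E y) = sesq (K + P + P) x y) :
    ∃ J : H →L[ℂ] H, IsSelfAdjoint J ∧ ∀ x y, inner ℂ (E x) (J (E y)) = sesq K x y := by
  obtain ⟨H', _, _, _, E', -, hE'⟩ := exists_kolmogorov hP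
  have hn : ∀ y, ‖E' y‖ ≤ 1 * ‖E y‖ := fun y => by
    rw [one_mul, ← sq_le_sq₀ (norm_nonneg _) (norm_nonneg _), ← inner_self_eq_norm_sq (𝕜 := ℂ),
      ← inner_self_eq_norm_sq (𝕜 := ℂ), hE, hE', sesq_add]
    simpa using sesq_self_re_nonneg hKP y
  set V : H →L[ℂ] H' := E'.extendOfNorm E with hV
  have hVE : ∀ y, V (E y) = E' y := LinearMap.extendOfNorm_eq hd ⟨1, hn⟩
  refine ⟨1 - (2 : ℂ) • (V.adjoint ∘L V), ?_, fun x y => ?_⟩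
  · rw [IsSelfAdjoint, star_sub, star_one, star_smul, ContinuousLinearMap.star_eq_adjoint,
      ContinuousLinearMap.adjoint_comp, ContinuousLinearMap.adjoint_adjoint]
    simp
  · simp only [sub_apply, one_apply_eq_self,
      smul_apply, ContinuousLinearMap.comp_apply, inner_sub_right,
      inner_smul_right, ContinuousLinearMap.adjoint_inner_right, hVE, hE, hE', sesq_add,
      LinearMap.add_apply]
    ring

/-- A self-adjoint operator is the difference of the squares of the square roots of its positive
and negative parts, which multiply to zero and commute with its commutant. -/
theorem exists_sq_sub_sq {H : Type*} [NormedAddCommGroup H] [InnerProductSpace ℂ H]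
    [CompleteSpace H] {J : H →L[ℂ] H} (hJ : IsSelfAdjoint J) :
    ∃ T S : H →L[ℂ] H, IsSelfAdjoint T ∧ IsSelfAdjoint S ∧ J = T * T - S * S ∧ T * S = 0 ∧
      ∀ A, Commute A J → Commute A T ∧ Commute A S := by
  refine ⟨cfc (fun t : ℝ => √(max t 0)) J, cfc (fun t : ℝ => √(max (-t) 0)) J,
    cfc_predicate _ _, cfc_predicate _ _, ?_, ?_,
    fun A hA => ⟨(hA.symm.cfc_real _).symm, (hA.symm.cfc_real _).symm⟩⟩
  · rw [← cfc_mul .., ← cfc_mul .., ← cfc_sub ..]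
    conv_lhs => rw [← cfc_id ℝ J]
    refine cfc_congr fun t _ => ?_
    rcases le_total t 0 with h | h <;> simp [h]
  · rw [← cfc_mul .., ← cfc_zero ℝ J]
    refine cfc_congr fun t _ => ?_
    rcases le_total t 0 with h | h <;> simp [h]

/-- If the form `⟨·, J ·⟩` is nonnegative up to finitely many squares, then the negative part of
`J` has finite rank: on its range the form is negative definite, so the finitely many functionals
`⟨v i, J ·⟩` separate points there. -/
theorem finiteDimensional_range_of_negative {H : Type*} [NormedAddCommGroup H]
    [InnerProductSpace ℂ H] [CompleteSpace H] {J T S : H →L[ℂ] H} (hS : IsSelfAdjoint S)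
    (hJ : J = T * T - S * S) (hTS : T * S = 0) {m : ℕ} (v : Fin m → H)
    (hpos : ∀ y, 0 ≤ (inner ℂ y (J y)).re + ∑ i, ‖inner ℂ (v i) (J y)‖ ^ 2) :
    FiniteDimensional ℂ (LinearMap.range S.toLinearMap) := by
  let c : H →ₗ[ℂ] (Fin m → ℂ) :=
    LinearMap.pi fun i => (innerₛₗ ℂ (v i)).comp J.toLinearMap
  refine FiniteDimensional.of_injective (c.domRestrict (LinearMap.range S.toLinearMap)) ?_
  rw [← LinearMap.ker_eq_bot, LinearMap.ker_eq_bot']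
  rintro ⟨_, z, rfl⟩ hz
  have hz' : ∀ i, inner ℂ (v i) (J (S z)) = 0 := fun i => congrFun hz i
  have h1 := hpos (S z)
  have h2 : inner ℂ (S z) (J (S z)) = -((‖S (S z)‖ ^ 2 : ℝ) : ℂ) := by
    have h3 : T (S z) = 0 := congrArg (· z) hTS
    have h4 : inner ℂ (S z) (S (S (S z))) = inner ℂ (S (S z)) (S (S z)) :=
      (hS.isSymmetric (S z) (S (S z))).symm
    rw [hJ]
    simp [h3, h4]
  have h5 : S (S z) = 0 := by
    rw [h2, Complex.neg_re, Complex.ofReal_re] at h1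
    simp only [hz', norm_zero] at h1
    have : ‖S (S z)‖ ^ 2 ≤ 0 := by simpa using h1
    simpa using this
  have h6 : S z = 0 := by
    rw [← inner_self_eq_zero (𝕜 := ℂ)]
    have : inner ℂ (S z) (S z) = inner ℂ z (S (S z)) := hS.isSymmetric z (S z)
    rw [this, h5, inner_zero_right]
  exact Subtype.ext h6

theorem IsQPD.exists_decomposition {φ : G → ℂ} (hφ : IsQPD φ) (hb : ∃ C : ℝ, ∀ g, ‖φ g‖ ≤ C) :
    ∃ φ₁ φ₂ : G → ℂ, IsPD φ₁ ∧ IsPDFiniteType φ₂ ∧ ∀ g, φ g = φ₁ g - φ₂ g := by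
  obtain ⟨m, n, -, hpos⟩ := hφ.exists_maximal_negative
  obtain ⟨ψ, hψ, hφψ⟩ := hφ.exists_dominating hb
  obtain ⟨H, _, _, _, E, hd, hE⟩ := exists_kolmogorov (hφψ.add hψ)
  obtain ⟨U, hUE, hU⟩ := exists_unitary_extension hd fun k x y => by
    simp only [hE, sesq_add, LinearMap.add_apply, sesq_groupKernel_translate]
  obtain ⟨J, hJ, hJE⟩ := exists_selfAdjoint_representing hd hψ hφψ hE
  -- invariance of the form of `φ` under translations
  have hcomm : ∀ k, Commute (U k) J := fun k => by
    refine ContinuousLinearMap.ext fun y => ?_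
    refine congrFun (hd.equalizer (ContinuousLinearMap.continuous _)
      (ContinuousLinearMap.continuous _) (funext fun b => ?_)) y
    refine hd.eq_of_inner_right ℂ fun a => ?_
    have h0 : translate k (translate k⁻¹ a) = a := by
      rw [← Module.End.mul_apply, ← map_mul, mul_inv_cancel, map_one, Module.End.one_apply]
    have h1 : E a = U k (E (translate k⁻¹ a)) := by rw [hUE, h0]
    simp only [mul_apply_eq_comp, Function.comp_apply]
    rw [hUE, hJE, h1, hU, hJE, ← sesq_groupKernel_translate φ k, h0]
  obtain ⟨T, S, hT, hS, hJTS, hTS, hTSU⟩ := exists_sq_sub_sq hJ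
  have hTU : ∀ k x, T (U k x) = U k (T x) := fun k x =>
    congrArg (· x) (hTSU _ (hcomm k)).1.symm.eq
  have hSU : ∀ k x, S (U k x) = U k (S x) := fun k x =>
    congrArg (· x) (hTSU _ (hcomm k)).2.symm.eq
  have hfin : FiniteDimensional ℂ (LinearMap.range S.toLinearMap) := by
    refine finiteDimensional_range_of_negative hS hJTS hTS (fun i => E (n i)) fun y => ?_
    refine hd.induction_on y (isClosed_le continuous_const ?_) fun a => ?_
    · refine (Complex.continuous_re.comp (by fun_prop)).add ?_
      fun_prop
    · simpa only [hJE] using hpos a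
  set x : H := E (Finsupp.single 1 1) with hx
  refine ⟨fun g => inner ℂ (T x) (U g (T x)), fun g => inner ℂ (S x) (U g (S x)),
    isPD_of_inner U hU _, isPDFiniteType_of_inner U hU (LinearMap.range S.toLinearMap) ?_
      ⟨x, rfl⟩, fun g => ?_⟩
  · rintro g _ ⟨z, rfl⟩
    exact ⟨U g z, hSU g z⟩
  · have h1 : φ g = inner ℂ x (J (U g x)) := by
      rw [hx, hUE, hJE]
      simp
    have h2 : ∀ w, inner ℂ x (T (T w)) = inner ℂ (T x) (T w) := fun w =>
      (hT.isSymmetric x (T w)).symm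
    have h3 : ∀ w, inner ℂ x (S (S w)) = inner ℂ (S x) (S w) := fun w =>
      (hS.isSymmetric x (S w)).symm
    rw [h1, hJTS, sub_apply, mul_apply_eq_comp, mul_apply_eq_comp, inner_sub_right, h2, h3, hTU,
      hSU]

end

end QuasiPD

theorem theorem5p1 {G : Type*} [Group G] (φ : G → ℂ) (hφ : QuasiPD.IsQPD φ)
    (hb : ∃ C : ℝ, ∀ g, ‖φ g‖ ≤ C) :
    ∃ φ₁ φ₂ : G → ℂ, QuasiPD.IsPD φ₁ ∧ QuasiPD.IsPDFiniteType φ₂ ∧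
      ∀ g, φ g = φ₁ g - φ₂ g :=
  hφ.exists_decomposition hb
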